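/- Model. Consider a single-hop radio network of $n\ge 2$ nodes with unique ids $1,\dots,n$ and $C\ge 1$ channels, operating in synchronous rounds. At the beginning an adversary activates an arbitrary nonempty set $S$ of nodes; the other nodes only listen, on the default channel $1$. In each round every active node chooses one channel, on which it either transmits a message or receives. Collision detection: a node receiving on a channel obtains the message if exactly one node transmits on that channel, and otherwise learns whether no node or at least two nodes transmit on it; a transmitting node learns whether it is the only transmitter on its channel. An algorithm is an arbitrary randomized one: the action of an active node is any function of its id, $n$, $C$, its random seed, and its observations in the earlier rounds (active nodes do not know $S$; the seeds may have any joint law, in particular they may be independent). Wake-up is solved in the first round in which exactly one active node transmits on channel $1$. An algorithm solves wake-up with high probability in $t$ rounds if for every nonempty $S$, with probability at least $1-\frac1n$, wake-up is solved within the first $t$ rounds. Theorem. There is an absolute constant $c>0$ such that for all integers $n\ge 2$ and $C\ge 1$, every algorithm for $n$ nodes and $C$ channels with collision detection that solves wake-up with high probability in $t$ rounds satisfies $$t\;\ge\; c\left(\frac{\log_2 n}{\log_2\max(C,2)}+\log_2\log_2 n\right).$$ In particular, if an algorithm solves wake-up with high probability in $f(n,C)$ rounds, then for every $C\ge1$,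 $f(n,C)\in\Omega\!\left(\frac{\log n}{\log C}+\log\log n\right)$, where for $C=1$ the first term is read as $\log n$. -/

import Mathlib

open MeasureTheory

universe u v

/-- What a node does in one round of a radio network with `C` channels: it tunes to exactly one
channel, on which it either transmits a message or receives. -/
inductive RadioAction (C : ℕ) (Msg : Type u) : Type u
  | transmit (c : Fin C) (m : Msg)
  | receive (c : Fin C)

/-- What a node perceives at the end of a round, with collision detection. A receiving node
perceives silence, a message, or a collision; a transmitting node perceives whether it was alone
on its channel or collided with another transmission. -/
inductive RadioObservation (Msg : Type u) : Type u
  | silence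
  | message (m : Msg)
  | collision
  | alone

/-- The message, if any, that a node performing the given action transmits on channel `c`. -/
def RadioAction.sentOn {C : ℕ} {Msg : Type u} (c : Fin C) : RadioAction C Msg → Option Msg
  | .transmit c' m => if c' = c then some m else none
  | .receive _ => none

/-- The messages transmitted on channel `c` by the active nodes (one entry per transmitter), when
`S` is the set of active nodes and node `j` performs the action `a j` if it is active. Inactive
nodes only listen, so they never transmit. -/
def radioTransmissions {n C : ℕ} {Msg : Type u} (S : Finset (Fin n))
    (a : Fin n → RadioAction C Msg) (c : Fin C) : List Msg :=
  (List.finRange n).filterMap fun j => if j ∈ S then (a j).sentOn c else none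

/-- The observation of the active node `i` in a single hop network with collision detection. -/
def radioObserve {n C : ℕ} {Msg : Type u} (S : Finset (Fin n))
    (a : Fin n → RadioAction C Msg) (i : Fin n) : RadioObservation Msg :=
  match a i with
  | .transmit c _ =>
      match radioTransmissions S a c with
      | [_] => .alone
      | _ => .collision
  | .receive c =>
      match radioTransmissions S a c with
      | [] => .silence
      | [m] => .message m
      | _ => .collision

/-- A randomized algorithm for a single hop radio network of `n` nodes, with ids `Fin n`, and `C`
channels. Node `i` draws a random seed; its action in a round is an arbitrary function of its id,
its seed and everything it has observed in the earlier rounds (most recent observation first).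
Its own earlier actions are determined by these data. The messages, the seeds and the joint law of
the seeds are arbitrary; private coins are the case in which the law is a product measure. -/
structure WakeupAlgorithm (n C : ℕ) where
  /-- the messages that may be sent -/
  Msg : Type u
  /-- the possible random seeds of each node -/
  Seed : Fin n → Type v
  /-- the events about each node's seed -/
  [seedMeasurable : ∀ i, MeasurableSpace (Seed i)]
  /-- the joint law of the seeds -/
  law : Measure (∀ i, Seed i)
  [isProbability : IsProbabilityMeasure law]
  /-- the behaviour of an active node -/
  act : (i : Fin n) → Seed i → List (RadioObservation Msg) → RadioAction C Msg

namespace WakeupAlgorithm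

variable {n C : ℕ}

attribute [instance] seedMeasurable isProbability

/-- What node `i` has observed in the first `r` rounds (most recent first), if `S` is the set of
nodes activated at the beginning of the execution and `ω` gives the seeds. -/
def history (A : WakeupAlgorithm.{u, v} n C) (S : Finset (Fin n)) (ω : ∀ i, A.Seed i) :
    ℕ → Fin n → List (RadioObservation A.Msg)
  | 0, _ => []
  | r + 1, i =>
      radioObserve S (fun j => A.act j (ω j) (A.history S ω r j)) i :: A.history S ω r i

/-- The action of the active node `i` in round `r`, counted from `0`. -/
def actionAt (A : WakeupAlgorithm.{u, v} n C) (S : Finset (Fin n)) (ω : ∀ i, A.Seed i)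
    (r : ℕ) (i : Fin n) : RadioAction C A.Msg :=
  A.act i (ω i) (A.history S ω r i)

/-- Exactly one active node transmits in round `r` on the default channel, the channel with
index `0`. -/
def WakesUpAt (A : WakeupAlgorithm.{u, v} n C) (S : Finset (Fin n)) (ω : ∀ i, A.Seed i)
    (r : ℕ) : Prop :=
  ∃! i : Fin n, i ∈ S ∧
    ∃ (c : Fin C) (m : A.Msg), (c : ℕ) = 0 ∧ A.actionAt S ω r i = .transmit c m

/-- The event that wake-up is solved within the first `t` rounds. The inactive nodes stay inactive
until the first round in which `WakesUpAt` holds, so `history` describes the network up to that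
round; what woken nodes do afterwards does not affect the event. -/
def wakeupEvent (A : WakeupAlgorithm.{u, v} n C) (S : Finset (Fin n)) (t : ℕ) :
    Set (∀ i, A.Seed i) :=
  {ω | ∃ r < t, A.WakesUpAt S ω r}

/-- The algorithm solves wake-up with high probability, that is with probability at least
`1 - 1 / n`, in `t` rounds, whatever nonempty set of nodes the adversary activates. -/
def SolvesWakeupWHP (A : WakeupAlgorithm.{u, v} n C) (t : ℕ) : Prop :=
  ∀ S : Finset (Fin n), S.Nonempty →
    MeasurableSet (A.wakeupEvent S t) ∧ (1 : ℝ) - 1 / (n : ℝ) ≤ A.law.real (A.wakeupEvent S t)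

end WakeupAlgorithm

/-! The adversary only needs sets of two nodes. For fixed seeds, label the nodes so that two equally
labelled nodes, activated together, never break symmetry. With `K` labels, Cauchy-Schwarz gives at
least `n ^ 2 / K - n` ordered pairs of distinct nodes with equal labels, while the expected number
of failing pairs is at most `n * (n - 1) / n`; hence `n < 2 * K`.

Two labellings give the two terms. Recording the `t` modes a node goes through when its partner
mimics it takes `(2 * C) ^ t` labels. Recording the node's kind (receive, transmit on the default
channel, transmit elsewhere) after every word of symmetric observations takes `3 ^ (t * 3 ^ t)`
labels, whatever `C` is. -/

/-- Two nodes that agree on a labelling of the nodes by finitely many labels: by Cauchy-Schwarz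
there are many such ordered pairs. -/
theorem sq_card_le_card_mul_pairs {ι κ : Type*} [Fintype ι] [DecidableEq ι] [Fintype κ]
    [DecidableEq κ] (lab : ι → κ) :
    (Fintype.card ι : ℝ) ^ 2 ≤ Fintype.card κ * (Fintype.card ι +
      ∑ p ∈ (Finset.univ : Finset ι).offDiag, if lab p.1 = lab p.2 then (1 : ℝ) else 0) := by
  have h1 : (Fintype.card ι : ℝ) = ∑ k : κ, ∑ i : ι, if lab i = k then (1 : ℝ) else 0 := by
    rw [Finset.sum_comm]
    simp
  have h2 : ∑ k : κ, (∑ i : ι, if lab i = k then (1 : ℝ) else 0) ^ 2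
      = ∑ p : ι × ι, if lab p.1 = lab p.2 then (1 : ℝ) else 0 := by
    simp_rw [sq, Finset.sum_mul_sum]
    rw [Fintype.sum_prod_type, Finset.sum_comm]
    refine Finset.sum_congr rfl fun i _ => ?_
    rw [Finset.sum_comm]
    refine Finset.sum_congr rfl fun j _ => ?_
    simp [eq_comm]
  have h3 : ∑ p : ι × ι, (if lab p.1 = lab p.2 then (1 : ℝ) else 0)
      = Fintype.card ι +
        ∑ p ∈ (Finset.univ : Finset ι).offDiag, if lab p.1 = lab p.2 then (1 : ℝ) else 0 := by
    rw [← Finset.univ_product_univ, ← Finset.diag_union_offDiag,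
      Finset.sum_union (Finset.disjoint_diag_offDiag _), Finset.sum_diag]
    simp
  have h4 := sq_sum_le_card_mul_sum_sq (s := (Finset.univ : Finset κ))
    (f := fun k => ∑ i : ι, if lab i = k then (1 : ℝ) else 0)
  rw [← h1, h2, h3, Finset.card_univ] at h4
  exact h4

/-! ### What two active nodes perceive -/

theorem length_radioTransmissions {n C : ℕ} {Msg : Type u} (S : Finset (Fin n))
    (a : Fin n → RadioAction C Msg) (c : Fin C) :
    (radioTransmissions S a c).length = (S.filter fun j => ((a j).sentOn c).isSome).card := by
  rw [radioTransmissions, List.length_filterMap_eq_countP, List.countP_eq_length_filter,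
    ← List.toFinset_card_of_nodup ((List.nodup_finRange n).filter _)]
  congr 1
  ext j
  by_cases hj : j ∈ S <;> simp [hj]

namespace RadioAction

variable {C : ℕ} {Msg : Type u}

/-- Whether the action is a transmission, together with its channel. -/
def mode : RadioAction C Msg → Bool × Fin C
  | .transmit c _ => (true, c)
  | .receive c => (false, c)

/-- Whether the action is a transmission, and if so, whether on the default channel. -/
def kind : RadioAction C Msg → Option Bool
  | .transmit c _ => some (decide ((c : ℕ) = 0))
  | .receive _ => none

theorem kind_eq_of_mode_eq {a b : RadioAction C Msg} (h : a.mode = b.mode) : a.kind = b.kind := by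
  cases a <;> cases b <;> simp_all [mode, kind]

theorem kind_eq_some_true_iff {a : RadioAction C Msg} :
    a.kind = some true ↔ ∃ (c : Fin C) (m : Msg), (c : ℕ) = 0 ∧ a = .transmit c m := by
  cases a with
  | transmit c m => simp [kind]
  | receive c => simp [kind]

/-- What a node perceives if all active nodes, at least two, act in the same mode. -/
def cloneObservation : RadioAction C Msg → RadioObservation Msg
  | .transmit _ _ => .collision
  | .receive _ => .silence

end RadioAction

section Pair

variable {n C : ℕ} {Msg : Type u} {a : Fin n → RadioAction C Msg} {i j : Fin n}

theorem length_radioTransmissions_pair (hij : i ≠ j) (c : Fin C) :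
    (radioTransmissions {i, j} a c).length =
      (if ((a i).sentOn c).isSome then 1 else 0) + if ((a j).sentOn c).isSome then 1 else 0 := by
  rw [length_radioTransmissions, Finset.card_filter, Finset.sum_pair hij]

theorem radioObserve_pair_of_mode_eq (hij : i ≠ j) (h : (a i).mode = (a j).mode) :
    radioObserve {i, j} a i = (a i).cloneObservation := by
  rcases hi : a i with ⟨c, m⟩ | ⟨c⟩ <;> rcases hj : a j with ⟨d, m'⟩ | ⟨d⟩ <;>
    simp [hi, hj, RadioAction.mode] at h
  all_goals
    subst h
    have hl := length_radioTransmissions_pair (a := a) hij c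
    simp [hi, hj, RadioAction.sentOn] at hl
  · simp only [radioObserve, hi, RadioAction.cloneObservation]
    split
    · simp_all
    · rfl
  · simp [radioObserve, hi, RadioAction.cloneObservation, hl]

/-- Channels may now differ, but then two transmitters are both alone and two receivers both hear
silence. No message is ever received, since neither node transmits while the other receives. -/
theorem radioObserve_pair_of_kind_eq (hij : i ≠ j) (h : (a i).kind = (a j).kind) :
    radioObserve {i, j} a i = radioObserve {i, j} a j ∧
      radioObserve {i, j} a i ∈ ({.silence, .collision, .alone} : Set (RadioObservation Msg)) := by
  by_cases hm : (a i).mode = (a j).mode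
  · have h1 := radioObserve_pair_of_mode_eq hij hm
    have h2 := radioObserve_pair_of_mode_eq hij.symm hm.symm
    rw [Finset.pair_comm] at h2
    rw [h1, h2]
    rcases hi : a i with ⟨c, m⟩ | ⟨c⟩ <;> rcases hj : a j with ⟨d, m'⟩ | ⟨d⟩ <;>
      simp_all [RadioAction.cloneObservation, RadioAction.mode]
  · rcases hi : a i with ⟨c, m⟩ | ⟨c⟩ <;> rcases hj : a j with ⟨d, m'⟩ | ⟨d⟩ <;>
      simp [hi, hj, RadioAction.mode, RadioAction.kind] at h hm
    all_goals
      have hc := length_radioTransmissions_pair (a := a) hij c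
      have hd := length_radioTransmissions_pair (a := a) hij d
      simp [hi, hj, RadioAction.sentOn, hm, Ne.symm hm] at hc hd
    · obtain ⟨x, hx⟩ := List.length_eq_one_iff.mp hc
      obtain ⟨y, hy⟩ := List.length_eq_one_iff.mp hd
      simp [radioObserve, hi, hj, hx, hy]
    · simp [radioObserve, hi, hj, hc, hd]

end Pair

/-! ### Counting labels -/

namespace WakeupAlgorithm

variable {n C : ℕ} (A : WakeupAlgorithm.{u, v} n C)

theorem not_wakesUpAt_pair {ω : ∀ i, A.Seed i} {r : ℕ} {i j : Fin n} (hij : i ≠ j)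
    (h : (A.actionAt {i, j} ω r i).kind = (A.actionAt {i, j} ω r j).kind) :
    ¬ A.WakesUpAt {i, j} ω r := by
  rintro ⟨k, ⟨hk, hk'⟩, huniq⟩
  rw [← RadioAction.kind_eq_some_true_iff] at hk'
  simp only [← RadioAction.kind_eq_some_true_iff] at huniq
  simp only [Finset.mem_insert, Finset.mem_singleton] at hk huniq
  rcases hk with rfl | rfl
  · exact hij (huniq j ⟨Or.inr rfl, h ▸ hk'⟩).symm
  · exact hij (huniq i ⟨Or.inl rfl, h ▸ hk'⟩)

/-- If equally labelled pairs of nodes never wake up, then an algorithm that succeeds with high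
probability needs at least `n / 2` labels. -/
theorem lt_two_mul_card_of_labelling {t : ℕ} (hn : 1 ≤ n) (hA : A.SolvesWakeupWHP t)
    {κ : Type*} [Fintype κ] (lab : (∀ i, A.Seed i) → Fin n → κ)
    (hlab : ∀ ω i j, i ≠ j → lab ω i = lab ω j → ω ∉ A.wakeupEvent {i, j} t) :
    n < 2 * Fintype.card κ := by
  classical
  let E : Fin n × Fin n → Set (∀ i, A.Seed i) := fun p => (A.wakeupEvent {p.1, p.2} t)ᶜ
  have hE : ∀ p, MeasurableSet (E p) := fun p => (hA {p.1, p.2} (by simp)).1.compl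
  have hn0 : (0 : ℝ) < n := by exact_mod_cast hn
  have hP : ∀ p, A.law.real (E p) ≤ 1 / n := fun p => by
    have h := hA {p.1, p.2} (by simp)
    rw [probReal_compl_eq_one_sub h.1]
    linarith [h.2]
  have hint : ∀ p ∈ (Finset.univ : Finset (Fin n)).offDiag,
      Integrable (fun ω => (E p).indicator (fun _ => (1 : ℝ)) ω) A.law := fun p _ =>
    (integrable_const 1).indicator (hE p)
  have hup : ∫ ω, ∑ p ∈ (Finset.univ : Finset (Fin n)).offDiag,
      (E p).indicator (fun _ => (1 : ℝ)) ω ∂A.law ≤ n - 1 := by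
    rw [integral_finsetSum _ hint]
    calc _ = ∑ p ∈ (Finset.univ : Finset (Fin n)).offDiag, A.law.real (E p) := by
          refine Finset.sum_congr rfl fun p _ => ?_
          rw [integral_indicator_const _ (hE p)]
          simp
      _ ≤ ∑ p ∈ (Finset.univ : Finset (Fin n)).offDiag, (1 / n : ℝ) :=
          Finset.sum_le_sum fun p _ => hP p
      _ = n - 1 := by
          rw [Finset.sum_const, Finset.offDiag_card, nsmul_eq_mul,
            Nat.cast_sub (Nat.le_mul_self _)]
          simp
          field_simp
  -- This holds for each `ω` separately and its right side involves only the events `E p`, so `lab`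
  -- need not be measurable.
  have hK : ∀ ω, (n : ℝ) ^ 2 ≤ Fintype.card κ * (n + ∑ p ∈ (Finset.univ : Finset (Fin n)).offDiag,
      (E p).indicator (fun _ => (1 : ℝ)) ω) := fun ω => by
    have h := sq_card_le_card_mul_pairs (lab ω)
    rw [Fintype.card_fin] at h
    refine h.trans ?_
    gcongr with p hp
    have hne : p.1 ≠ p.2 := by simpa using hp
    split_ifs with hl
    · have : ω ∈ E p := hlab ω _ _ hne hl
      simp [this]
    · exact Set.indicator_nonneg (fun _ _ => zero_le_one) _
  have hI := integrable_finsetSum _ hint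
  have hmono : ∫ _, (n : ℝ) ^ 2 ∂A.law ≤ ∫ ω, Fintype.card κ *
      (n + ∑ p ∈ (Finset.univ : Finset (Fin n)).offDiag,
        (E p).indicator (fun _ => (1 : ℝ)) ω) ∂A.law :=
    integral_mono (integrable_const _) (((integrable_const _).add hI).const_mul _) hK
  rw [integral_const_mul, integral_add (integrable_const _) hI] at hmono
  simp only [integral_const, probReal_univ, one_smul] at hmono
  have hfin : (n : ℝ) ^ 2 ≤ Fintype.card κ * (2 * n - 1) :=
    hmono.trans (by gcongr; linarith)
  have hpos : (0 : ℝ) < Fintype.card κ := by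
    by_contra! h
    nlinarith [sq_nonneg (n : ℝ), (Nat.one_le_cast (α := ℝ)).2 hn]
  have : (n : ℝ) < 2 * Fintype.card κ := by nlinarith
  exact_mod_cast this

/-! ### Labelling by modes along the clone history -/

/-- The history of node `i` when every active node behaves like `i`. -/
def cloneHistory (A : WakeupAlgorithm.{u, v} n C) (ω : ∀ i, A.Seed i) (i : Fin n) : ℕ → List (RadioObservation A.Msg)
  | 0 => []
  | r + 1 => (A.act i (ω i) (A.cloneHistory ω i r)).cloneObservation :: A.cloneHistory ω i r

/-- While the modes agree, each node's run depends on its own id and seed alone, so it can be read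
off a label. -/
theorem history_pair_eq_cloneHistory {ω : ∀ i, A.Seed i} {i j : Fin n} (hij : i ≠ j) {t : ℕ}
    (h : ∀ r < t, (A.act i (ω i) (A.cloneHistory ω i r)).mode
      = (A.act j (ω j) (A.cloneHistory ω j r)).mode) :
    ∀ r ≤ t, A.history {i, j} ω r i = A.cloneHistory ω i r ∧
      A.history {i, j} ω r j = A.cloneHistory ω j r := by
  intro r
  induction r with
  | zero => simp [history, cloneHistory]
  | succ r ih =>
    intro hr
    obtain ⟨h1, h2⟩ := ih (by omega)
    have hm := h r hr
    rw [← h1, ← h2] at hm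
    have e1 := radioObserve_pair_of_mode_eq
      (a := fun k => A.act k (ω k) (A.history {i, j} ω r k)) hij hm
    have e2 := radioObserve_pair_of_mode_eq
      (a := fun k => A.act k (ω k) (A.history {i, j} ω r k)) hij.symm hm.symm
    rw [Finset.pair_comm j i] at e2
    simp only [history, cloneHistory]
    rw [e1, e2, h1, h2]
    exact ⟨rfl, rfl⟩

theorem lt_two_mul_two_mul_pow {t : ℕ} (hn : 1 ≤ n) (hA : A.SolvesWakeupWHP t) :
    n < 2 * (2 * C) ^ t := by
  have h := A.lt_two_mul_card_of_labelling hn hA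
    (fun ω i (r : Fin t) => (A.act i (ω i) (A.cloneHistory ω i r)).mode) ?_
  · simpa using h
  rintro ω i j hij hl ⟨r, hr, hw⟩
  have hm : ∀ r < t, (A.act i (ω i) (A.cloneHistory ω i r)).mode
      = (A.act j (ω j) (A.cloneHistory ω j r)).mode := fun r hr => congrFun hl ⟨r, hr⟩
  obtain ⟨h1, h2⟩ := A.history_pair_eq_cloneHistory hij hm r hr.le
  refine A.not_wakesUpAt_pair hij (RadioAction.kind_eq_of_mode_eq ?_) hw
  rw [actionAt, actionAt, h1, h2]
  exact hm r hr

/-! ### Labelling by the whole decision tree -/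

/-- The observations that two active nodes can share. -/
def symmetricObservation (Msg : Type u) : Fin 3 → RadioObservation Msg :=
  ![.silence, .collision, .alone]

theorem history_pair_symmetric {ω : ∀ i, A.Seed i} {i j : Fin n} (hij : i ≠ j) {t : ℕ}
    (h : ∀ r < t, ∀ x : Fin r → Fin 3,
      (A.act i (ω i) (List.ofFn fun k => symmetricObservation A.Msg (x k))).kind
        = (A.act j (ω j) (List.ofFn fun k => symmetricObservation A.Msg (x k))).kind) :
    ∀ r ≤ t, A.history {i, j} ω r i = A.history {i, j} ω r j ∧
      ∃ x : Fin r → Fin 3,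
        A.history {i, j} ω r i = List.ofFn fun k => symmetricObservation A.Msg (x k) := by
  intro r
  induction r with
  | zero => simp [history]
  | succ r ih =>
    intro hr
    obtain ⟨h1, x, hx⟩ := ih (by omega)
    have hk := h r hr x
    rw [← hx] at hk
    nth_rewrite 2 [h1] at hk
    obtain ⟨e1, e2⟩ := radioObserve_pair_of_kind_eq
      (a := fun k => A.act k (ω k) (A.history {i, j} ω r k)) hij hk
    obtain ⟨y, hy⟩ : ∃ y, radioObserve {i, j}
        (fun k => A.act k (ω k) (A.history {i, j} ω r k)) i = symmetricObservation A.Msg y := by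
      rcases e2 with e | e | e
      exacts [⟨0, e⟩, ⟨1, e⟩, ⟨2, e⟩]
    refine ⟨by simp only [history]; rw [e1, h1], Fin.cons y x, ?_⟩
    simp only [history]
    rw [hy, hx, List.ofFn_succ]
    simp

theorem lt_two_mul_three_pow {t : ℕ} (hn : 1 ≤ n) (hA : A.SolvesWakeupWHP t) :
    n < 2 * 3 ^ (t * 3 ^ t) := by
  have h := A.lt_two_mul_card_of_labelling hn hA
    (fun ω i (p : Fin t × (Fin t → Fin 3)) => (A.act i (ω i) (List.ofFn fun k : Fin p.1 =>
      symmetricObservation A.Msg (p.2 (k.castLE p.1.2.le)))).kind) ?_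
  · simpa using h
  rintro ω i j hij hl ⟨r, hr, hw⟩
  have hm : ∀ r < t, ∀ x : Fin r → Fin 3,
      (A.act i (ω i) (List.ofFn fun k => symmetricObservation A.Msg (x k))).kind
        = (A.act j (ω j) (List.ofFn fun k => symmetricObservation A.Msg (x k))).kind := by
    intro r hr x
    -- Labels are indexed by words of full length `t`; padding with `0` is harmless, as only the
    -- first `r` letters are read.
    have := congrFun hl (⟨r, hr⟩, fun k => if hk : (k : ℕ) < r then x ⟨k, hk⟩ else 0)
    simpa using this
  obtain ⟨h1, x, hx⟩ := A.history_pair_symmetric hij hm r hr.le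
  refine A.not_wakesUpAt_pair hij ?_ hw
  rw [actionAt, actionAt, ← h1, hx]
  exact hm r hr x

end WakeupAlgorithm

/-! ### Taking logarithms -/

theorem logb_div_logb_max_le {n C t : ℕ} (hn : 2 ≤ n) (hC : 1 ≤ C) (h : n < 2 * (2 * C) ^ t) :
    Real.logb 2 n / Real.logb 2 (max (C : ℝ) 2) ≤ 1 + 2 * t := by
  set M : ℝ := max (C : ℝ) 2 with hM
  have hM2 : (2 : ℝ) ≤ M := le_max_right _ _
  have hL : 1 ≤ Real.logb 2 M := by
    rw [Real.le_logb_iff_rpow_le one_lt_two (by linarith)]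
    simpa
  have hn0 : (0 : ℝ) < n := by positivity
  -- Both `2` and `C` are at most `M`, so `2 * C ≤ M * M`.
  have hle : (n : ℝ) ≤ 2 * (M * M) ^ t := by
    have : (n : ℝ) ≤ 2 * (2 * C) ^ t := by exact_mod_cast h.le
    refine this.trans ?_
    gcongr
    exact le_max_left _ _
  have hlog := Real.logb_le_logb_of_le one_lt_two hn0 hle
  have hM0 : M ≠ 0 := by positivity
  rw [Real.logb_mul two_ne_zero (by positivity), Real.logb_pow, Real.logb_mul hM0 hM0,
    Real.logb_self_eq_one one_lt_two] at hlog
  rw [div_le_iff₀ (by linarith)]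
  nlinarith

theorem logb_logb_le {n t : ℕ} (hn : 2 ≤ n) (h : n < 2 * 3 ^ (t * 3 ^ t)) :
    Real.logb 2 (Real.logb 2 n) ≤ 3 * t + 2 := by
  have hnat : n ≤ 2 ^ 2 ^ (3 * t + 2) := by
    have h1 : t * 3 ^ t ≤ 2 ^ (3 * t) := calc
      t * 3 ^ t ≤ 2 ^ t * 4 ^ t := by
        gcongr
        · exact Nat.lt_two_pow_self.le
        · norm_num
      _ = 2 ^ (3 * t) := by rw [← mul_pow, pow_mul]; norm_num
    calc n ≤ 2 * 3 ^ (t * 3 ^ t) := h.le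
      _ ≤ 2 * 4 ^ 2 ^ (3 * t) := by
        gcongr
        · norm_num
        · norm_num
      _ = 2 ^ (1 + 2 * 2 ^ (3 * t)) := by rw [pow_add, pow_mul 2 2, pow_one, show 2 ^ 2 = 4 from rfl]
      _ ≤ 2 ^ 2 ^ (3 * t + 2) := by
        have := Nat.one_le_two_pow (n := 3 * t)
        gcongr
        · norm_num
        · rw [pow_add]; omega
  have hle : (n : ℝ) ≤ 2 ^ 2 ^ (3 * t + 2) := by exact_mod_cast hnat
  have h2 := Real.logb_le_logb_of_le one_lt_two (by positivity) hle
  rw [Real.logb_pow, Real.logb_self_eq_one one_lt_two, mul_one] at h2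
  push_cast at h2
  have hpos : 0 < Real.logb 2 (n : ℝ) := Real.logb_pos one_lt_two (by exact_mod_cast hn)
  have h3 := Real.logb_le_logb_of_le one_lt_two hpos h2
  rw [Real.logb_pow, Real.logb_self_eq_one one_lt_two, mul_one] at h3
  exact_mod_cast h3

theorem mainTheorem10 :
    ∃ c : ℝ, 0 < c ∧
      ∀ (n C : ℕ), 2 ≤ n → 1 ≤ C →
        ∀ (A : WakeupAlgorithm.{u, v} n C) (t : ℕ), A.SolvesWakeupWHP t →
          c * (Real.logb 2 (n : ℝ) / Real.logb 2 (max (C : ℝ) 2)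
            + Real.logb 2 (Real.logb 2 (n : ℝ))) ≤ (t : ℝ) := by
  -- The two bounds add up to `5 * t + 3`, which is at most `8 * t` once `1 ≤ t`.
  refine ⟨1 / 8, by norm_num, fun n C hn hC A t hA => ?_⟩
  have h1 := A.lt_two_mul_two_mul_pow (by omega) hA
  have h2 := A.lt_two_mul_three_pow (by omega) hA
  have ht : 1 ≤ t := by
    by_contra! h
    obtain rfl : t = 0 := by omega
    simp at h1
    omega
  have ht' : (1 : ℝ) ≤ t := by exact_mod_cast ht
  linarith [logb_div_logb_max_le hn hC h1, logb_logb_le hn h2]
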